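/- Conventions. $\mu$ is Lebesgue measure on $\mathbb{R}^2$. A disc is a compact subset of $\mathbb{R}^2$; $\mathfrak{K}_{ccs}$ is the class of convex discs $K$ with $K=-K$. A lattice $\mathbf{L}$ (a discrete additive subgroup of $\mathbb{R}^2$ of full rank) is $K$-admissible if no nonzero point of $\mathbf{L}$ lies in the interior of $K$; $\Delta(K)$ is the infimum of $\det(\mathbf{L})$ over the $K$-admissible lattices; a critical lattice of $K$ is a $K$-admissible lattice with $\det(\mathbf{L})=\Delta(K)$. A support line of $K$ is a line that contains a point of $K$ and does not separate any points of $K$. $\mathfrak{K}_{bal}$ is the class of $K\in\mathfrak{K}_{ccs}$ such that every boundary point of $K$ lies on a unique critical lattice of $K$ (in particular $K$ is irreducible) and on a unique support line of $K$. Let $e_j=\exp(2\pi i j/6)$, viewed as points of $\mathbb{R}^2$. $K$ is in circle representation if all $e_j$ lie on the boundary of $K$ and $\Delta(K)=\sqrt3/2$. A critical hexagon of $K\in\mathfrak{K}_{bal}$ is the hexagon bounded by the support lines of $K$ at points $\pm E_0,\pm E_1,\pm E_2$ of a critical lattice of $K$ that lie on the boundary of $K$ and satisfy $E_0-E_1+E_2=0$.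 For $z=x+iy$ with $y>0$ put $X_z=\begin{pmatrix} x/y & -(x^2+y^2)/y\\ 1/y & -x/y\end{pmatrix}$, and let $$\mathfrak{h}^*=\{x+iy : y>0,\ -1/\sqrt3<x<1/\sqrt3,\ x^2+y^2>1/3\}.$$ For $z\in\mathfrak{h}^*$ let $P_j$ be the point of intersection of the lines $e_j+\mathbb{R}X_ze_j$ and $e_{j+1}+\mathbb{R}X_ze_{j+1}$ ($j$ modulo $6$, so $P_{j+3}=-P_j$), let $H(z)$ be the hexagon with vertices $\pm P_0,\pm P_1,\pm P_2$, and let $Q_j$ be the point of intersection of the lines $P_{j-1}P_j$ and $P_{j+1}P_{j+2}$. For $i\in\{0,1,2\}$ let $T_i(z)$ be the area of the triangle $e_iP_ie_{i+1}$ and $A_i(z)$ the area of the triangle $P_iQ_iP_{i+1}$. With the index $i+1$ taken modulo $3$, put $$\mathfrak{h}_i=\{z\in\mathfrak{h}^* : T_i(z)\ge A_{i+1}(z)\},\qquad \mathrm{area}_i(z)=\mathbf{1}_{\mathfrak{h}_i}(z)\left(T_i(z)-\sqrt{A_{i+1}(z)\,T_i(z)}\right).$$ Theorem. If $K\in\mathfrak{K}_{bal}$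 is in circle representation and has $H(z)$ as a critical hexagon for some $z\in\mathfrak{h}_0\cup\mathfrak{h}_1\cup\mathfrak{h}_2$, then $$\mu(K)\ \ge\ \frac{3\sqrt3}{2}+2\sum_{i=0}^{2}\mathrm{area}_i(z).$$ Moreover, $\mathfrak{h}_0\cap\mathfrak{h}_1\cap\mathfrak{h}_2=\emptyset$. -/

import Mathlib

open MeasureTheory

namespace Reinhardt

noncomputable section

/-- The plane `ℝ²`. Only its affine structure, topology and Lebesgue measure are used. -/
abbrev Plane : Type := Fin 2 → ℝ

/-- The wedge (determinant) `u ∧ v` of two plane vectors. -/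
def wedge (u v : Plane) : ℝ := u 0 * v 1 - u 1 * v 0

/-- The class of convex discs that are centrally symmetric about the origin
(a disc is a compact subset of the plane). -/
def Kccs : Set (Set Plane) :=
  {K | IsCompact K ∧ Convex ℝ K ∧ ∀ p ∈ K, -p ∈ K}

/-- A line is a one-dimensional affine subspace; it is a support line of `K` if it contains a point
of `K` and does not separate any two points of `K`. -/
def IsSupportLine (K : Set Plane) (l : AffineSubspace ℝ Plane) : Prop :=
  Module.finrank ℝ l.direction = 1 ∧ (∃ p ∈ K, p ∈ l) ∧
    ∀ p ∈ K, ∀ q ∈ K, ¬ l.SOppSide p q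

/-- A lattice is a discrete additive subgroup of the plane of full rank. -/
def IsLattice (L : Submodule ℤ Plane) : Prop :=
  ∃ _ : DiscreteTopology L, IsZLattice ℝ L

/-- `L` is a `K`-admissible lattice: no nonzero point of `L` is interior to `K`. -/
def IsAdmissible (K : Set Plane) (L : Submodule ℤ Plane) : Prop :=
  IsLattice L ∧ ∀ p ∈ L, p ∈ interior K → p = 0

/-- The minimal determinant `Δ(K)`: the infimum of the determinants (covolumes) of the
`K`-admissible lattices. -/
def minDet (K : Set Plane) : ℝ :=
  sInf {d | ∃ L : Submodule ℤ Plane, IsAdmissible K L ∧ d = ZLattice.covolume L}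

/-- A critical lattice of `K` is a `K`-admissible lattice whose determinant is `Δ(K)`. -/
def IsCriticalLattice (K : Set Plane) (L : Submodule ℤ Plane) : Prop :=
  IsAdmissible K L ∧ ZLattice.covolume L = minDet K

/-- `K` is irreducible: each boundary point lies on a critical lattice of `K`. -/
def IsIrreducible (K : Set Plane) : Prop :=
  ∀ p ∈ frontier K, ∃ L, IsCriticalLattice K L ∧ p ∈ L

/-- The class of balanced discs: the irreducible centrally symmetric convex discs without corners
(there is a unique support line at each boundary point), each of whose boundary points lies on a
unique critical lattice. -/
def Kbal : Set (Set Plane) :=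
  {K | K ∈ Kccs ∧ IsIrreducible K ∧
    (∀ p ∈ frontier K, ∃! l, IsSupportLine K l ∧ p ∈ l) ∧
    (∀ p ∈ frontier K, ∃! L, IsCriticalLattice K L ∧ p ∈ L)}

/-- The sixth root of unity `e_j = exp(2πij/6)` as a point of the plane. -/
def root (j : ℤ) : Plane :=
  ![Real.cos (2 * Real.pi * j / 6), Real.sin (2 * Real.pi * j / 6)]

/-- `K` is in circle representation: the sixth roots of unity lie on its boundary, and
`Δ(K) = √3 / 2`, the normalization under which critical hexagons of `K` have area `√12`. -/
def InCircleRep (K : Set Plane) : Prop :=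
  (∀ j : ℤ, root j ∈ frontier K) ∧ minDet K = Real.sqrt 3 / 2

/-- `H` is a critical hexagon of `K` (for a disc `K` without corners): there are points
`E₀, E₁, E₂` of a critical lattice on the boundary of `K`, with `E₀ - E₁ + E₂ = 0`, such that `H` is
the region bounded by the support lines `±l₀, ±l₁, ±l₂` of `K` at `±E₀, ±E₁, ±E₂`, that is, the set
of the points that none of these six lines separates from the origin. -/
def IsCriticalHexagon (K H : Set Plane) : Prop :=
  ∃ (L : Submodule ℤ Plane) (E : Fin 3 → Plane) (l : Fin 3 → AffineSubspace ℝ Plane),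
    IsCriticalLattice K L ∧
    (∀ i, E i ∈ L ∧ E i ∈ frontier K) ∧
    E 0 - E 1 + E 2 = 0 ∧
    (∀ i, IsSupportLine K (l i) ∧ E i ∈ l i) ∧
    H = {p | ∀ i, ¬ (l i).SOppSide 0 p ∧ ¬ (l i).SOppSide 0 (-p)}

/-- The matrix `X_z` in `sl₂(ℝ)` of a point `z = x + iy` of the upper half-plane. -/
def X (z : UpperHalfPlane) : Matrix (Fin 2) (Fin 2) ℝ :=
  !![z.re / z.im, -(z.re ^ 2 + z.im ^ 2) / z.im; 1 / z.im, -(z.re / z.im)]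

/-- The star domain `h*` (an open ideal triangle in the upper half-plane). -/
def starDomain : Set UpperHalfPlane :=
  {z | -(1 / Real.sqrt 3) < z.re ∧ z.re < 1 / Real.sqrt 3 ∧ 1 / 3 < z.re ^ 2 + z.im ^ 2}

/-- The point of intersection of the lines `p + ℝu` and `q + ℝv` (Cramer's rule), provided that
`u` and `v` are not parallel. -/
def lineInter (p u q v : Plane) : Plane :=
  p + (wedge (q - p) v / wedge u v) • u

theorem lineInter_mem (p u q v : Plane) (huv : wedge u v ≠ 0) :
    (∃ s : ℝ, lineInter p u q v = p + s • u) ∧ (∃ s : ℝ, lineInter p u q v = q + s • v) := by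
  refine ⟨⟨_, rfl⟩, ⟨wedge (q - p) u / wedge u v, ?_⟩⟩
  have key : ∀ i : Fin 2, wedge u v * (q - p) i = wedge (q - p) v * u i - wedge (q - p) u * v i := by
    intro i
    fin_cases i <;> simp [wedge] <;> ring
  ext i
  have hk := key i
  simp only [lineInter, Pi.add_apply, Pi.smul_apply, Pi.sub_apply, smul_eq_mul] at hk ⊢
  field_simp
  linarith

/-- The vertex `P_j`: the intersection of the lines `e_j + ℝ X_z e_j` and
`e_{j+1} + ℝ X_z e_{j+1}`. Indices are taken modulo six, and `P_{j+3} = -P_j`. -/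
def P (z : UpperHalfPlane) (j : ℤ) : Plane :=
  lineInter (root j) ((X z).mulVec (root j)) (root (j + 1)) ((X z).mulVec (root (j + 1)))

/-- The hexagon `H(z)` with vertices `P₀, P₁, P₂, -P₀, -P₁, -P₂`. -/
def hexagon (z : UpperHalfPlane) : Set Plane :=
  convexHull ℝ {P z 0, P z 1, P z 2, -P z 0, -P z 1, -P z 2}

/-- The point `Q_j`: the intersection of the lines `P_{j-1}P_j` and `P_{j+1}P_{j+2}`. -/
def Q (z : UpperHalfPlane) (j : ℤ) : Plane :=
  lineInter (P z (j - 1)) (P z j - P z (j - 1)) (P z (j + 1)) (P z (j + 2) - P z (j + 1))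

/-- The area `T_i(z)` of the triangle `e_i P_i e_{i+1}`. -/
def T (i : Fin 3) (z : UpperHalfPlane) : ℝ :=
  volume.real (convexHull ℝ {root (i : ℕ), P z (i : ℕ), root ((i : ℕ) + 1)})

/-- The area `A_i(z)` of the triangle `P_i Q_i P_{i+1}`. -/
def A (i : Fin 3) (z : UpperHalfPlane) : ℝ :=
  volume.real (convexHull ℝ {P z (i : ℕ), Q z (i : ℕ), P z ((i : ℕ) + 1)})

/-- The region `h_i` of the points `z` in the star domain with `T_i(z) ≥ A_{i+1}(z)`, where the
index `i + 1` in `Fin 3` is taken modulo three. -/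
def region (i : Fin 3) : Set UpperHalfPlane :=
  {z | z ∈ starDomain ∧ T i z ≥ A (i + 1) z}

/-- The function `area_i`, supported on `h_i`. -/
def area (i : Fin 3) : UpperHalfPlane → ℝ :=
  (region i).indicator fun z => T i z - Real.sqrt (A (i + 1) z * T i z)

end

end Reinhardt

/-! Write s_j for `halfEdge z j`, so that P_j = e_j + s_j X e_j. The s_j have period 3 and are
positive on the star domain; three consecutive ones r, s, t satisfy rs + st + tr = 1
(`halfEdge_relation`). For j = i they give T_i = (√3/4) rs and A_{i+1} = √3 t².

The support lines put K inside H(z). Fix a chord e_j e_{j+1} and let σ be a point of K farthest out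
in the direction normal to it. Its height over the chord is (1 - τ) times that of P_j, with 0 ≤ τ ≤
1. The triangles 0 e_j σ and 0 σ e_{j+1} lie in K and have total area √3/4 + (1 - τ) T_j, so an
upper bound for τ is needed.

That bound comes from Δ(K) = √3/2. Drop the two sides of H(z) through ±e_{j+2}: this leaves a
parallelogram with corners ±P_j. Cut these corners off by the lines through ±σ parallel to the
chord. K still lies in the resulting hexagon, whose edge midpoints span a K-admissible lattice with
determinant a quarter of the hexagon's area (`minDet_le_of_subset_hexagon`). Dropping two sides
added 2 A_{j+1} and the cuts removed 2 τ² T_j, so minimality of Δ(K) forces τ² T_j ≤ A_{j+1}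
(`cut_bound`). Hence (1 - τ) T_j ≥ T_j - √(A_{j+1} T_j), and also (1 - τ) T_j ≥ 0. Adding over the
six sectors gives the bound. -/

namespace Reinhardt

/-! ### Areas of triangles -/

/-- The open triangle with vertices `0`, `v`, `w`. -/
def openTriangle (v w : Plane) : Set Plane :=
  {p | ∃ x y : ℝ, 0 < x ∧ 0 < y ∧ x + y < 1 ∧ p = x • v + y • w}

theorem volume_standard_triangle :
    volume {p : Plane | 0 < p 0 ∧ 0 < p 1 ∧ p 0 + p 1 < 1} = ENNReal.ofReal (1 / 2) := by
  have h1 : {p : Plane | 0 < p 0 ∧ 0 < p 1 ∧ p 0 + p 1 < 1} =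
      MeasurableEquiv.finTwoArrow ⁻¹'
        (regionBetween (fun _ : ℝ => (0 : ℝ)) (fun x => 1 - x) (Set.Ioo 0 1)) := by
    ext p
    simp only [Set.mem_ofPred_eq, Set.mem_preimage, regionBetween, MeasurableEquiv.finTwoArrow_apply,
      Set.mem_Ioo]
    constructor
    · rintro ⟨a, b, c⟩; exact ⟨⟨a, by linarith⟩, b, by linarith⟩
    · rintro ⟨⟨a, _⟩, b, c⟩; exact ⟨a, b, by linarith⟩
  rw [h1, (volume_preserving_finTwoArrow ℝ).measure_preimage_equiv, Measure.volume_eq_prod,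
    volume_regionBetween_eq_integral]
  · congr 1
    rw [← integral_Ioc_eq_integral_Ioo, ← intervalIntegral.integral_of_le zero_le_one]
    simp only [Pi.sub_apply, sub_zero]
    rw [intervalIntegral.integral_sub (by simp) (by simp)]
    norm_num
  · exact (continuous_const.integrableOn_Icc).mono_set Set.Ioo_subset_Icc_self
  · exact ((continuous_const.sub continuous_id).integrableOn_Icc).mono_set Set.Ioo_subset_Icc_self
  · exact measurableSet_Ioo
  · intro x hx; linarith [hx.2]

theorem openTriangle_eq_image (v w : Plane) :
    openTriangle v w = Matrix.toLin' !![v 0, w 0; v 1, w 1] ''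
      {p : Plane | 0 < p 0 ∧ 0 < p 1 ∧ p 0 + p 1 < 1} := by
  have key : ∀ p : Plane, Matrix.toLin' !![v 0, w 0; v 1, w 1] p = p 0 • v + p 1 • w := by
    intro p
    ext i
    fin_cases i <;> simp [Matrix.mulVec, dotProduct, Fin.sum_univ_two] <;> ring
  ext p
  constructor
  · rintro ⟨x, y, hx, hy, hxy, rfl⟩
    exact ⟨![x, y], by simpa using ⟨hx, hy, hxy⟩, by rw [key]; simp⟩
  · rintro ⟨q, ⟨hx, hy, hxy⟩, rfl⟩
    exact ⟨q 0, q 1, hx, hy, hxy, key q⟩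

theorem volume_openTriangle (v w : Plane) :
    volume (openTriangle v w) = ENNReal.ofReal (|wedge v w| / 2) := by
  rw [openTriangle_eq_image, Measure.addHaar_image_linearMap, LinearMap.det_toLin',
    Matrix.det_fin_two_of, volume_standard_triangle, ← ENNReal.ofReal_mul (abs_nonneg _)]
  congr 1
  rw [wedge, mul_comm (w 0) (v 1)]
  ring

theorem convex_openTriangle (v w : Plane) : Convex ℝ (openTriangle v w) := by
  rw [openTriangle_eq_image]
  apply Convex.linear_image
  rintro p ⟨p0, p1, p2⟩ q ⟨q0, q1, q2⟩ a b ha hb hab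
  simp only [Set.mem_ofPred_eq, Pi.add_apply, Pi.smul_apply, smul_eq_mul]
  rcases ha.eq_or_lt with rfl | ha
  · obtain rfl : b = 1 := by linarith
    simpa using ⟨q0, q1, q2⟩
  · exact ⟨by positivity, by positivity, by nlinarith⟩

theorem measurableSet_openTriangle (v w : Plane) (h : wedge v w ≠ 0) :
    MeasurableSet (openTriangle v w) := by
  rw [openTriangle_eq_image]
  have hd : LinearMap.det (Matrix.toLin' !![v 0, w 0; v 1, w 1]) ≠ 0 := by
    rw [LinearMap.det_toLin', Matrix.det_fin_two_of]
    rwa [wedge, mul_comm (v 1)] at h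
  have hinj := (LinearMap.equivOfDetNeZero _ hd).injective
  refine MeasurableSet.image_of_continuousOn_injOn ?_
    (LinearMap.continuous_of_finiteDimensional _).continuousOn hinj.injOn
  exact (measurableSet_lt measurable_const (measurable_pi_apply 0)).inter
    ((measurableSet_lt measurable_const (measurable_pi_apply 1)).inter
    (measurableSet_lt ((measurable_pi_apply 0).add (measurable_pi_apply 1)) measurable_const))

/-- The area of a triangle. -/
theorem volume_real_triangle (a b c : Plane) :
    volume.real (convexHull ℝ {a, b, c}) = |wedge (b - a) (c - a)| / 2 := by
  set v := b - a
  set w := c - a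
  set U : Set Plane := (fun p => a + p) '' openTriangle v w with hU
  have hvolU : volume U = ENNReal.ofReal (|wedge v w| / 2) := by
    rw [hU, Set.image_add_left, measure_preimage_add, volume_openTriangle]
  have hconv : Convex ℝ U := (convex_openTriangle v w).translate a
  have hmem : ∀ x y : ℝ, 0 < x → 0 < y → x + y < 1 → a + (x • v + y • w) ∈ U :=
    fun x y hx hy hxy => ⟨_, ⟨x, y, hx, hy, hxy, rfl⟩, rfl⟩
  have hsub : U ⊆ convexHull ℝ {a, b, c} := by
    rintro _ ⟨_, ⟨x, y, hx, hy, hxy, rfl⟩, rfl⟩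
    have h3 : a + (x • v + y • w) = (1 - x - y) • a + x • b + y • c := by
      simp only [v, w]; module
    have := (convex_convexHull ℝ ({a, b, c} : Set Plane)).sum_mem (t := Finset.univ)
      (w := ![1 - x - y, x, y]) (z := ![a, b, c])
      (by intro i _; fin_cases i <;> simp <;> linarith)
      (by simp [Fin.sum_univ_three]; ring)
      (by intro i _; apply subset_convexHull; fin_cases i <;> simp)
    simpa [Fin.sum_univ_three, h3] using this
  have hvert : ∀ α β : ℝ, 0 ≤ α → 0 ≤ β → α + β ≤ 1 → a + (α • v + β • w) ∈ closure U := by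
    intro α β hα hβ hαβ
    -- The open segment from the centroid to a point of the closed triangle stays in the open
    -- triangle.
    have h1 : openSegment ℝ (a + ((1 / 3 : ℝ) • v + (1 / 3 : ℝ) • w)) (a + (α • v + β • w)) ⊆ U := by
      rintro _ ⟨s, t, hs, ht, hst, rfl⟩
      have : s • (a + ((1 / 3 : ℝ) • v + (1 / 3 : ℝ) • w)) + t • (a + (α • v + β • w)) =
          a + ((s / 3 + t * α) • v + (s / 3 + t * β) • w) := by
        obtain rfl : s = 1 - t := by linarith
        module
      rw [this]
      exact hmem _ _ (by positivity) (by positivity) (by nlinarith)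
    apply closure_mono h1
    rw [closure_openSegment]
    exact right_mem_segment _ _ _
  have hsup : convexHull ℝ {a, b, c} ⊆ closure U := by
    apply convexHull_min _ hconv.closure
    rintro p (rfl | rfl | rfl)
    · simpa using hvert 0 0 le_rfl le_rfl (by norm_num)
    · simpa [v] using hvert 1 0 (by norm_num) le_rfl (by norm_num)
    · simpa [w] using hvert 0 1 le_rfl (by norm_num) (by norm_num)
  have hcl : volume (closure U) = volume U := by
    refine le_antisymm ?_ (measure_mono subset_closure)
    calc volume (closure U) ≤ volume (U ∪ frontier U) := by
          rw [closure_eq_self_union_frontier]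
      _ ≤ volume U + volume (frontier U) := measure_union_le _ _
      _ = volume U := by rw [hconv.addHaar_frontier volume, add_zero]
  have : volume (convexHull ℝ {a, b, c}) = volume U :=
    le_antisymm (hcl ▸ measure_mono hsup) (measure_mono hsub)
  rw [measureReal_def, this, hvolU, ENNReal.toReal_ofReal (by positivity)]

/-! ### Upper bounds for the minimal determinant; the wedge product -/

/-- Two vectors with nonzero wedge span a lattice, whose covolume is the absolute value of the
wedge. -/
theorem isLattice_span_pair (u v : Plane) (h : wedge u v ≠ 0) :
    IsLattice (Submodule.span ℤ {u, v}) ∧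
      ZLattice.covolume (Submodule.span ℤ {u, v}) = |wedge u v| := by
  have hli : LinearIndependent ℝ ![u, v] := by
    rw [LinearIndependent.pair_iff]
    intro s t hst
    have h0 := congrFun hst 0
    have h1 := congrFun hst 1
    simp only [Pi.add_apply, Pi.smul_apply, smul_eq_mul, Pi.zero_apply] at h0 h1
    unfold wedge at h
    constructor
    · apply (mul_eq_zero.mp (_ : s * (u 0 * v 1 - u 1 * v 0) = 0)).resolve_right h
      linear_combination v 1 * h0 - v 0 * h1
    · apply (mul_eq_zero.mp (_ : t * (u 0 * v 1 - u 1 * v 0) = 0)).resolve_right h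
      linear_combination u 0 * h1 - u 1 * h0
  let b := basisOfLinearIndependentOfCardEqFinrank hli (by simp)
  have hb : ⇑b = ![u, v] := coe_basisOfLinearIndependentOfCardEqFinrank _ _
  have hspan : Submodule.span ℤ {u, v} = Submodule.span ℤ (Set.range b) := by
    rw [hb, Matrix.range_cons_cons_empty]
  rw [hspan]
  refine ⟨⟨inferInstance, inferInstance⟩, ?_⟩
  rw [ZLattice.covolume_eq_measure_fundamentalDomain _ volume
    (ZSpan.isAddFundamentalDomain b volume), ZSpan.volume_real_fundamentalDomain, hb,
    Matrix.det_fin_two]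
  simp [wedge, mul_comm]

theorem minDet_le_abs_wedge (K : Set Plane) (u v : Plane) (h : wedge u v ≠ 0)
    (hadm : ∀ m n : ℤ, m • u + n • v ∈ interior K → m • u + n • v = 0) :
    minDet K ≤ |wedge u v| := by
  obtain ⟨h1, h2⟩ := isLattice_span_pair u v h
  refine csInf_le ⟨0, ?_⟩ ⟨_, ⟨h1, ?_⟩, h2.symm⟩
  · rintro _ ⟨L, _, rfl⟩
    exact ENNReal.toReal_nonneg
  · intro p hp hpK
    obtain ⟨m, n, rfl⟩ := Submodule.mem_span_pair.mp hp
    exact hadm m n hpK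

theorem wedge_add_left (u v w : Plane) : wedge (u + v) w = wedge u w + wedge v w := by
  simp [wedge]; ring

theorem wedge_add_right (u v w : Plane) : wedge u (v + w) = wedge u v + wedge u w := by
  simp [wedge]; ring

theorem wedge_sub_left (u v w : Plane) : wedge (u - v) w = wedge u w - wedge v w := by
  simp [wedge]; ring

theorem wedge_sub_right (u v w : Plane) : wedge u (v - w) = wedge u v - wedge u w := by
  simp [wedge]; ring

theorem wedge_smul_left (c : ℝ) (u v : Plane) : wedge (c • u) v = c * wedge u v := by
  simp [wedge]; ring

theorem wedge_smul_right (c : ℝ) (u v : Plane) : wedge u (c • v) = c * wedge u v := by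
  simp [wedge]; ring

theorem wedge_neg_left (u v : Plane) : wedge (-u) v = -wedge u v := by
  simp [wedge]; ring

theorem wedge_neg_right (u v : Plane) : wedge u (-v) = -wedge u v := by
  simp [wedge]; ring

theorem wedge_self (u : Plane) : wedge u u = 0 := by
  simp [wedge]; ring

theorem wedge_swap (u v : Plane) : wedge u v = -wedge v u := by
  simp [wedge]; ring

theorem eq_smul_add_smul {u v : Plane} (h : wedge u v ≠ 0) (p : Plane) :
    p = (wedge p v / wedge u v) • u + (wedge u p / wedge u v) • v := by
  ext i
  simp only [Pi.add_apply, Pi.smul_apply, smul_eq_mul]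
  field_simp
  fin_cases i <;> simp [wedge] <;> ring

/-- A linear functional is strictly below a bound valid on `K` at interior points of `K`. -/
theorem lt_of_mem_interior {K : Set Plane} (f : Plane →ₗ[ℝ] ℝ) {c : ℝ} (hK : ∀ p ∈ K, f p ≤ c)
    {v : Plane} (hv : 0 < f v) {p : Plane} (hp : p ∈ interior K) : f p < c := by
  have hc : Continuous fun t : ℝ => p + t • v := by fun_prop
  have h1 : (fun t : ℝ => p + t • v) ⁻¹' interior K ∈ nhds (0 : ℝ) :=
    (isOpen_interior.preimage hc).mem_nhds (by simpa using hp)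
  obtain ⟨ε, hε, hb⟩ := Metric.mem_nhds_iff.mp h1
  have h2 := hK _ (interior_subset (hb (show ε / 2 ∈ Metric.ball (0 : ℝ) ε by
    rw [Metric.mem_ball, dist_zero_right, Real.norm_eq_abs, abs_of_pos (by positivity)]
    linarith)))
  rw [map_add, map_smul, smul_eq_mul] at h2
  have := mul_pos (half_pos hε) hv
  linarith

/-- In the coordinates (φ, ψ) the lattice spanned by (1, -b/2) and (-a/2, 1) meets the open cut
parallelogram only at 0. For m > 0 the first two bounds force n > 0, then 2m - n < 2 and 2n - m < 2,
hence m = n = 1. That point is the midpoint of the cut edge, which the third, strict bound excludes.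
-/
theorem int_eq_zero_of_midpoint_lattice {a b : ℝ} (ha : 0 < a) (ha1 : a ≤ 1)
    (hb1 : b ≤ 1) {m n : ℤ} (hx : |m - n * a / 2| < 1) (hy : |n - m * b / 2| < 1)
    (hc : |b * (m - n * a / 2) + a * (n - m * b / 2)| < a + b - a * b) : m = 0 ∧ n = 0 := by
  have main : ∀ m n : ℤ, 0 ≤ m → |m - n * a / 2| < 1 → |n - m * b / 2| < 1 →
      |b * (m - n * a / 2) + a * (n - m * b / 2)| < a + b - a * b → m = 0 ∧ n = 0 := by
    intro m n hm hx hy hc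
    rw [abs_lt] at hx hy hc
    rcases hm.eq_or_lt with rfl | hm
    · refine ⟨rfl, ?_⟩
      simp only [Int.cast_zero, zero_mul, zero_div, sub_zero] at hy
      have h1 : -1 < n := by exact_mod_cast hy.1
      have h2 : n < 1 := by exact_mod_cast hy.2
      omega
    · have hm' : (1 : ℝ) ≤ m := by exact_mod_cast hm
      have hn : 0 < n := by
        by_contra hn
        have hn' : (n : ℝ) ≤ 0 := by exact_mod_cast not_lt.mp hn
        nlinarith
      have hn' : (1 : ℝ) ≤ n := by exact_mod_cast hn
      have h1 : (m : ℝ) - n / 2 < 1 := by nlinarith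
      have h2 : (n : ℝ) - m / 2 < 1 := by nlinarith
      have h3 : 2 * m - n < 2 := by
        have : (2 * m - n : ℝ) < 2 := by linarith
        exact_mod_cast this
      have h4 : 2 * n - m < 2 := by
        have : (2 * n - m : ℝ) < 2 := by linarith
        exact_mod_cast this
      obtain rfl : m = 1 := by omega
      obtain rfl : n = 1 := by omega
      exfalso
      simp only [Int.cast_one, one_mul] at hc
      nlinarith [hc.2]
  rcases le_total 0 m with hm | hm
  · exact main m n hm hx hy hc
  · have := main (-m) (-n) (by omega)
      (by rw [← abs_neg]; convert hx using 2; push_cast; ring)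
      (by rw [← abs_neg]; convert hy using 2; push_cast; ring)
      (by rw [← abs_neg]; convert hc using 2; push_cast; ring)
    omega

/-- The midpoints of the edges of the hexagon obtained from the parallelogram `|φ|, |ψ| ≤ 1` by
cutting off two opposite corners span an admissible lattice of every set inside the hexagon. -/
theorem minDet_le_of_subset_hexagon {K : Set Plane} (φ ψ : Plane →ₗ[ℝ] ℝ) {a b : ℝ} (ha : 0 < a)
    (ha1 : a ≤ 1) (hb : 0 < b) (hb1 : b ≤ 1) {u v : Plane} (huv : wedge u v ≠ 0)
    (hφu : φ u = 1) (hφv : φ v = -a / 2) (hψu : ψ u = -b / 2) (hψv : ψ v = 1)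
    (hφ : ∀ p ∈ K, |φ p| ≤ 1) (hψ : ∀ p ∈ K, |ψ p| ≤ 1)
    (hcut : ∀ p ∈ K, |b * φ p + a * ψ p| ≤ a + b - a * b) :
    minDet K ≤ |wedge u v| := by
  have strict : ∀ (f : Plane →ₗ[ℝ] ℝ) (c : ℝ) (w : Plane), 0 < f w → (∀ p ∈ K, |f p| ≤ c) →
      ∀ p ∈ interior K, |f p| < c := by
    intro f c w hw h p hp
    rw [abs_lt]
    constructor
    · have := lt_of_mem_interior (-f) (c := c) (v := -w) (fun p hp => by
        have := (abs_le.mp (h p hp)).1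
        simp only [LinearMap.neg_apply]; linarith) (by simpa using hw) hp
      simp only [LinearMap.neg_apply] at this
      linarith
    · exact lt_of_mem_interior f (fun p hp => (abs_le.mp (h p hp)).2) hw hp
  -- `u` and `v` are the midpoints of the edges φ = 1 and ψ = 1, which end at ψ = 1 - b and φ = 1 -
  -- a; `u + v` is the midpoint of the cut edge.
  apply minDet_le_abs_wedge K u v huv
  intro m n hp
  have e1 : φ (m • u + n • v) = m - n * a / 2 := by
    rw [map_add, map_zsmul, map_zsmul, hφu, hφv, zsmul_eq_mul, zsmul_eq_mul]; ring
  have e2 : ψ (m • u + n • v) = n - m * b / 2 := by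
    rw [map_add, map_zsmul, map_zsmul, hψu, hψv, zsmul_eq_mul, zsmul_eq_mul]; ring
  have h1 := strict φ 1 u (by rw [hφu]; norm_num) hφ _ hp
  have h2 := strict ψ 1 v (by rw [hψv]; norm_num) hψ _ hp
  have h3 := strict (b • φ + a • ψ) (a + b - a * b) (u + v)
    (by simp only [LinearMap.add_apply, LinearMap.smul_apply, smul_eq_mul, map_add, hφu, hφv, hψu,
          hψv]; nlinarith) (by simpa using hcut) _ hp
  simp only [LinearMap.add_apply, LinearMap.smul_apply, smul_eq_mul] at h3
  rw [e1] at h1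
  rw [e2] at h2
  rw [e1, e2] at h3
  obtain ⟨rfl, rfl⟩ := int_eq_zero_of_midpoint_lattice ha ha1 hb1 h1 h2 h3
  simp

/-! ### Sixth roots of unity -/

theorem root_add_two (j : ℤ) : root (j + 2) = root (j + 1) - root j := by
  have h1 : 2 * Real.pi * ((j + 2 : ℤ) : ℝ) / 6 =
      2 * Real.pi * ((j + 1 : ℤ) : ℝ) / 6 + Real.pi / 3 := by push_cast; ring
  have h2 : 2 * Real.pi * (j : ℝ) / 6 =
      2 * Real.pi * ((j + 1 : ℤ) : ℝ) / 6 - Real.pi / 3 := by push_cast; ring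
  ext i
  fin_cases i
  · simp only [root, h1, h2, Real.cos_add, Real.cos_sub]
    simp; ring
  · simp only [root, h1, h2, Real.sin_add, Real.sin_sub]
    simp; ring

theorem root_add_three (j : ℤ) : root (j + 3) = -root j := by
  have h := root_add_two (j + 1)
  rw [show j + 1 + 2 = j + 3 by ring, show j + 1 + 1 = j + 2 by ring, root_add_two j] at h
  rw [h]; abel

theorem root_zero : root 0 = ![1, 0] := by simp [root]

theorem root_one : root 1 = ![1 / 2, √3 / 2] := by
  have : 2 * Real.pi * ((1 : ℤ) : ℝ) / 6 = Real.pi / 3 := by push_cast; ring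
  rw [root, this, Real.cos_pi_div_three, Real.sin_pi_div_three]

theorem wedge_root_succ (j : ℤ) : wedge (root j) (root (j + 1)) = √3 / 2 := by
  have h1 : 2 * Real.pi * ((j + 1 : ℤ) : ℝ) / 6 =
      2 * Real.pi * (j : ℝ) / 6 + Real.pi / 3 := by push_cast; ring
  simp only [wedge, root, h1, Real.cos_add, Real.sin_add, Real.cos_pi_div_three,
    Real.sin_pi_div_three, Matrix.cons_val_zero, Matrix.cons_val_one]
  linear_combination √3 / 2 * Real.sin_sq_add_cos_sq (2 * Real.pi * (j : ℝ) / 6)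

/-! ### The hexagon H(z) in terms of its half-edges -/

section

variable (z : UpperHalfPlane)

theorem wedge_X_comm (u v : Plane) :
    wedge u ((X z).mulVec v) = wedge v ((X z).mulVec u) := by
  simp [wedge, X, Matrix.mulVec, dotProduct, Fin.sum_univ_two]
  ring

theorem wedge_X_X (u v : Plane) :
    wedge ((X z).mulVec u) ((X z).mulVec v) = wedge u v := by
  have := z.im_ne_zero
  simp [wedge, X, Matrix.mulVec, dotProduct, Fin.sum_univ_two]
  field_simp
  ring

/-- Since X has trace 0 and determinant 1, u ∧ Xv is a symmetric form of discriminant 1; this is its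
Gram determinant. -/
theorem gram_X (u v : Plane) :
    wedge u ((X z).mulVec u) * wedge v ((X z).mulVec v) - wedge u ((X z).mulVec v) ^ 2 =
      wedge u v ^ 2 := by
  have := z.im_ne_zero
  simp [wedge, X, Matrix.mulVec, dotProduct, Fin.sum_univ_two]
  field_simp
  ring

/-- The number `s` for which `P_j = e_j + s X_z e_j`: half the length of the edge of the hexagon
`H(z)` through `e_j`, relative to `X_z e_j`. -/
noncomputable def halfEdge (j : ℤ) : ℝ :=
  wedge (root (j + 2)) ((X z).mulVec (root (j + 1))) / (√3 / 2)

theorem halfEdge_add_three (j : ℤ) : halfEdge z (j + 3) = halfEdge z j := by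
  simp only [halfEdge]
  rw [show j + 3 + 2 = j + 2 + 3 by ring, show j + 3 + 1 = j + 1 + 3 by ring, root_add_three,
    root_add_three, Matrix.mulVec_neg, wedge_neg_left, wedge_neg_right, neg_neg]

theorem sqrt_three_pos : (0 : ℝ) < √3 := by positivity

theorem wedge_root_X_self_succ (j : ℤ) :
    wedge (root (j + 1)) ((X z).mulVec (root (j + 1))) =
      √3 / 2 * (halfEdge z j + halfEdge z (j + 2)) ∧
    wedge (root j) ((X z).mulVec (root j)) =
      √3 / 2 * (halfEdge z (j + 1) + halfEdge z (j + 2)) ∧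
    wedge (root j) ((X z).mulVec (root (j + 1))) = √3 / 2 * halfEdge z (j + 2) := by
  have h3 := sqrt_three_pos
  have e3 : root (j + 1 + 2) = -root j := by rw [← root_add_three]; ring_nf
  have e4 : root (j + 2 + 2) = -root (j + 1) := by rw [← root_add_three]; ring_nf
  have e5 : root (j + 2 + 1) = -root j := by rw [← root_add_three]; ring_nf
  have hc := wedge_X_comm z (root (j + 1)) (root j)
  simp only [halfEdge]
  rw [e3, e4, e5, show j + 1 + 1 = j + 2 by ring, root_add_two]
  simp only [Matrix.mulVec_neg, Matrix.mulVec_sub, wedge_neg_left, wedge_neg_right,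
    wedge_sub_left, wedge_sub_right, hc]
  refine ⟨?_, ?_, ?_⟩ <;> field_simp <;> ring

theorem wedge_root_X_self (j : ℤ) : wedge (root j) ((X z).mulVec (root j)) =
    √3 / 2 * (halfEdge z (j + 1) + halfEdge z (j + 2)) :=
  (wedge_root_X_self_succ z j).2.1

theorem wedge_root_X_succ (j : ℤ) :
    wedge (root j) ((X z).mulVec (root (j + 1))) = √3 / 2 * halfEdge z (j + 2) :=
  (wedge_root_X_self_succ z j).2.2

theorem wedge_root_succ_X_succ (j : ℤ) :
    wedge (root (j + 1)) ((X z).mulVec (root (j + 1))) =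
      √3 / 2 * (halfEdge z j + halfEdge z (j + 2)) :=
  (wedge_root_X_self_succ z j).1

/-- This is `gram_X` for two consecutive roots, whose three form values are √3/2 times sums of
half-edges. -/
theorem halfEdge_relation (j : ℤ) :
    halfEdge z j * halfEdge z (j + 1) + halfEdge z (j + 1) * halfEdge z (j + 2) +
      halfEdge z (j + 2) * halfEdge z j = 1 := by
  have h := gram_X z (root j) (root (j + 1))
  rw [wedge_root_X_self, wedge_root_succ_X_succ, wedge_root_X_succ, wedge_root_succ] at h
  have h3 := sqrt_three_pos
  have : (√3 / 2) ^ 2 ≠ 0 := by positivity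
  apply mul_left_cancel₀ this
  linear_combination h

theorem X_root (j : ℤ) : (X z).mulVec (root j) =
    -halfEdge z (j + 2) • root j + (halfEdge z (j + 1) + halfEdge z (j + 2)) • root (j + 1) := by
  have h3 := sqrt_three_pos
  rw [eq_smul_add_smul (by rw [wedge_root_succ]; positivity : wedge (root j) (root (j + 1)) ≠ 0)
    ((X z).mulVec (root j)), wedge_swap _ (root (j + 1)), wedge_X_comm, wedge_root_succ,
    wedge_root_X_succ, wedge_root_X_self]
  congr 2 <;> field_simp

theorem X_root_succ (j : ℤ) : (X z).mulVec (root (j + 1)) =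
    -(halfEdge z j + halfEdge z (j + 2)) • root j + halfEdge z (j + 2) • root (j + 1) := by
  have h3 := sqrt_three_pos
  rw [eq_smul_add_smul (by rw [wedge_root_succ]; positivity : wedge (root j) (root (j + 1)) ≠ 0)
    ((X z).mulVec (root (j + 1))), wedge_swap _ (root (j + 1)), wedge_root_succ,
    wedge_root_X_succ, wedge_root_succ_X_succ]
  congr 2 <;> field_simp

theorem P_eq_root_add (j : ℤ) : P z j = root j + halfEdge z j • (X z).mulVec (root j) := by
  rw [P, lineInter, wedge_X_X, wedge_root_succ, ← root_add_two, halfEdge]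

theorem P_eq (j : ℤ) : P z j = (halfEdge z (j + 1) * (halfEdge z j + halfEdge z (j + 2))) • root j +
    (halfEdge z j * (halfEdge z (j + 1) + halfEdge z (j + 2))) • root (j + 1) := by
  rw [P_eq_root_add, X_root]
  have h : root j = (halfEdge z j * halfEdge z (j + 1) + halfEdge z (j + 1) * halfEdge z (j + 2) +
      halfEdge z (j + 2) * halfEdge z j) • root j := by rw [halfEdge_relation, one_smul]
  nth_rewrite 1 [h]
  module

theorem P_eq_root_succ_sub (j : ℤ) :
    P z j = root (j + 1) - halfEdge z (j + 1) • (X z).mulVec (root (j + 1)) := by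
  rw [P_eq, X_root_succ]
  have h : root (j + 1) = (halfEdge z j * halfEdge z (j + 1) +
      halfEdge z (j + 1) * halfEdge z (j + 2) + halfEdge z (j + 2) * halfEdge z j) • root (j + 1) := by
    rw [halfEdge_relation, one_smul]
  nth_rewrite 2 [h]
  module

theorem P_add_three (j : ℤ) : P z (j + 3) = -P z j := by
  rw [P_eq_root_add, P_eq_root_add, root_add_three, halfEdge_add_three, Matrix.mulVec_neg]
  module

theorem P_succ (j : ℤ) :
    P z (j + 1) = P z j + (2 * halfEdge z (j + 1)) • (X z).mulVec (root (j + 1)) := by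
  rw [P_eq_root_add z (j + 1), P_eq_root_succ_sub z j]
  module

end

/-! ### Positivity on the star domain; the areas T and A -/

section

variable {z : UpperHalfPlane}

/-- The three walls of the ideal triangle correspond to the three half-edges: up to positive
factors, s_0, s_1, s_2 are 3|z|² - 1, 1 + √3 x and 1 - √3 x. -/
theorem halfEdge_pos (hz : z ∈ starDomain) (j : ℤ) : 0 < halfEdge z j := by
  have h3 := sqrt_three_pos
  have hsq : √3 ^ 2 = (3 : ℝ) := Real.sq_sqrt (by norm_num)
  obtain ⟨h1, h2, h4⟩ := hz
  have hy := z.im_pos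
  have h1' : -1 < √3 * z.re := by
    have := mul_lt_mul_of_pos_left h1 h3
    rwa [mul_neg, mul_one_div_cancel h3.ne'] at this
  have h2' : √3 * z.re < 1 := by
    have := mul_lt_mul_of_pos_left h2 h3
    rwa [mul_one_div_cancel h3.ne'] at this
  have e01 : wedge (root 0) ((X z).mulVec (root 1)) = (1 - √3 * z.re) / (2 * z.im) := by
    rw [root_zero, root_one]
    simp [wedge, X, Matrix.mulVec, dotProduct, Fin.sum_univ_two]
    field_simp
    ring
  have e00 : wedge (root 0) ((X z).mulVec (root 0)) = 1 / z.im := by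
    rw [root_zero]
    simp [wedge, X, Matrix.mulVec, dotProduct, Fin.sum_univ_two]
  have e11 : wedge (root 1) ((X z).mulVec (root 1)) =
      (1 - 2 * √3 * z.re + 3 * (z.re ^ 2 + z.im ^ 2)) / (4 * z.im) := by
    rw [root_one]
    simp [wedge, X, Matrix.mulVec, dotProduct, Fin.sum_univ_two]
    field_simp
    linear_combination 4 * (z.re ^ 2 + z.im ^ 2) * hsq
  have g01 := wedge_root_X_succ z 0
  have g00 := wedge_root_X_self z 0
  have g11 := wedge_root_succ_X_succ z 0
  simp only [zero_add] at g01 g00 g11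
  rw [e01] at g01
  rw [e00] at g00
  rw [e11] at g11
  have k0 : √3 / 2 * halfEdge z 0 = (3 * (z.re ^ 2 + z.im ^ 2) - 1) / (4 * z.im) := by
    rw [show √3 / 2 * halfEdge z 0 = √3 / 2 * (halfEdge z 0 + halfEdge z 2) -
      √3 / 2 * halfEdge z 2 by ring, ← g01, ← g11]
    field_simp
    ring
  have k1 : √3 / 2 * halfEdge z 1 = (1 + √3 * z.re) / (2 * z.im) := by
    rw [show √3 / 2 * halfEdge z 1 = √3 / 2 * (halfEdge z 1 + halfEdge z 2) -
      √3 / 2 * halfEdge z 2 by ring, ← g01, ← g00]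
    field_simp
    ring
  have hp : ∀ {x y : ℝ}, √3 / 2 * x = y → 0 < y → 0 < x := by
    rintro x _ rfl h
    exact pos_of_mul_pos_right h (by positivity)
  have p0 : 0 < halfEdge z 0 := hp k0 (div_pos (by linarith) (by positivity))
  have p1 : 0 < halfEdge z 1 := hp k1 (div_pos (by linarith) (by positivity))
  have p2 : 0 < halfEdge z 2 := hp g01.symm (div_pos (by linarith) (by positivity))
  have hper : Function.Periodic (halfEdge z) 3 := halfEdge_add_three z
  rw [← Int.emod_add_mul_ediv j 3, mul_comm 3, ← smul_eq_mul, hper.zsmul]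
  have : j % 3 = 0 ∨ j % 3 = 1 ∨ j % 3 = 2 := by omega
  rcases this with h | h | h <;> rw [h] <;> assumption

theorem volume_root_P_root (hz : z ∈ starDomain) (j : ℤ) :
    volume.real (convexHull ℝ {root j, P z j, root (j + 1)}) =
      √3 / 4 * (halfEdge z j * halfEdge z (j + 1)) := by
  rw [volume_real_triangle]
  have e1 : P z j - root j = halfEdge z j • (X z).mulVec (root j) := by
    rw [P_eq_root_add]; abel
  have e2 : root (j + 1) - root j = halfEdge z j • (X z).mulVec (root j) +
      halfEdge z (j + 1) • (X z).mulVec (root (j + 1)) := by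
    rw [← e1, P_eq_root_succ_sub]; abel
  rw [e1, e2, wedge_add_right, wedge_smul_left, wedge_smul_left, wedge_smul_right,
    wedge_smul_right, wedge_self, wedge_X_X, wedge_root_succ, abs_of_pos]
  · ring
  · have := halfEdge_pos hz j
    have := halfEdge_pos hz (j + 1)
    have := sqrt_three_pos
    simp only [mul_zero, zero_add]
    positivity

theorem volume_P_Q_P (hz : z ∈ starDomain) (j : ℤ) :
    volume.real (convexHull ℝ {P z j, Q z j, P z (j + 1)}) = √3 * halfEdge z (j + 1) ^ 2 := by
  have hs := halfEdge_pos hz j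
  have hs1 := halfEdge_pos hz (j + 1)
  have hs2 := halfEdge_pos hz (j + 2)
  have h3 := sqrt_three_pos
  have d0 : P z j - P z (j - 1) = (2 * halfEdge z j) • (X z).mulVec (root j) := by
    have := P_succ z (j - 1)
    rw [sub_add_cancel] at this
    rw [this]; abel
  have d1 : P z (j + 1) - P z j = (2 * halfEdge z (j + 1)) • (X z).mulVec (root (j + 1)) := by
    rw [P_succ]; abel
  have d2 : P z (j + 2) - P z (j + 1) =
      (2 * halfEdge z (j + 2)) • (X z).mulVec (root (j + 2)) := by
    rw [show j + 2 = j + 1 + 1 by ring, P_succ]; abel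
  have w02 : wedge (root j) (root (j + 2)) = √3 / 2 := by
    rw [root_add_two, wedge_sub_right, wedge_self, wedge_root_succ, sub_zero]
  have w12 : wedge (root (j + 1)) (root (j + 2)) = √3 / 2 := by
    rw [show j + 2 = j + 1 + 1 by ring, wedge_root_succ]
  -- The edge directions satisfy X e_{j+2} = X e_{j+1} - X e_j, so the triangle P_j Q_j P_{j+1} is
  -- an affine image of an equilateral one, with all sides scaled by 2 s_{j+1}.
  have hQ : Q z j = P z j + (2 * halfEdge z (j + 1)) • (X z).mulVec (root j) := by
    have e : P z (j + 1) - P z (j - 1) = (P z (j + 1) - P z j) + (P z j - P z (j - 1)) := by abel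
    rw [Q, lineInter, e, d0, d1, d2]
    simp only [wedge_add_left, wedge_smul_left, wedge_smul_right, wedge_X_X, w02, w12]
    have d0' : P z (j - 1) = P z j - (2 * halfEdge z j) • (X z).mulVec (root j) := by
      rw [← d0]; abel
    rw [d0']
    have : 2 * halfEdge z (j + 2) ≠ 0 := by positivity
    have : 2 * halfEdge z (j + 2) * (2 * halfEdge z (j + 1) * (√3 / 2) +
        2 * halfEdge z j * (√3 / 2)) /
        (2 * halfEdge z (j + 2) * (2 * halfEdge z j * (√3 / 2))) * (2 * halfEdge z j) =
        2 * halfEdge z (j + 1) + 2 * halfEdge z j := by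
      field_simp
    rw [smul_smul, this]
    module
  have e1 : Q z j - P z j = (2 * halfEdge z (j + 1)) • (X z).mulVec (root j) := by
    rw [hQ]; abel
  rw [volume_real_triangle, e1, d1, wedge_smul_left, wedge_smul_right, wedge_X_X, wedge_root_succ,
    abs_of_pos (by positivity)]
  ring

theorem T_eq (hz : z ∈ starDomain) (i : Fin 3) :
    T i z = √3 / 4 * (halfEdge z (i : ℕ) * halfEdge z ((i : ℕ) + 1)) :=
  volume_root_P_root hz _

theorem A_succ_eq (hz : z ∈ starDomain) (i : Fin 3) :
    A (i + 1) z = √3 * halfEdge z ((i : ℕ) + 2) ^ 2 := by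
  have h := halfEdge_add_three z 1
  norm_num at h
  fin_cases i
  · simpa [A] using volume_P_Q_P hz 1
  · simpa [A] using volume_P_Q_P hz 2
  · simpa [A, h] using volume_P_Q_P hz 0

/-- Adding the three inequalities 4t² ≤ rs, 4r² ≤ st, 4s² ≤ tr contradicts rs + st + tr ≤ r² + s² +
t², all numbers being positive. -/
theorem region_inter_eq_empty : region 0 ∩ region 1 ∩ region 2 = ∅ := by
  rw [Set.eq_empty_iff_forall_notMem]
  rintro z ⟨⟨⟨hz, h0⟩, _, h1⟩, _, h2⟩
  rw [T_eq hz, A_succ_eq hz] at h0 h1 h2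
  have e3 := halfEdge_add_three z 0
  have e4 := halfEdge_add_three z 1
  norm_num at h0 h1 h2 e3 e4
  rw [e3] at h1 h2
  rw [e4] at h2
  have p0 := halfEdge_pos hz 0
  have p1 := halfEdge_pos hz 1
  have p2 := halfEdge_pos hz 2
  set r := halfEdge z 0
  set s := halfEdge z 1
  set t := halfEdge z 2
  have h3 := sqrt_three_pos
  have g0 : 4 * t ^ 2 ≤ r * s := le_of_mul_le_mul_left (by linarith) h3
  have g1 : 4 * r ^ 2 ≤ s * t := le_of_mul_le_mul_left (by linarith) h3
  have g2 : 4 * s ^ 2 ≤ t * r := le_of_mul_le_mul_left (by linarith) h3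
  nlinarith [sq_nonneg (r - s), sq_nonneg (s - t), sq_nonneg (t - r), sq_pos_of_pos p0,
    sq_pos_of_pos p1, sq_pos_of_pos p2]

end

/-! ### How far K reaches beyond a chord -/

/-- The linear functional `p ↦ p ∧ v`. -/
def wedgeLeft (v : Plane) : Plane →ₗ[ℝ] ℝ where
  toFun p := wedge p v
  map_add' p q := wedge_add_left p q v
  map_smul' c p := wedge_smul_left c p v

@[simp]
theorem wedgeLeft_apply (v p : Plane) : wedgeLeft v p = wedge p v := rfl

section

variable {z : UpperHalfPlane}

theorem abs_wedge_P_le (hz : z ∈ starDomain) (j m : ℤ) :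
    |wedge (P z m) ((X z).mulVec (root j))| ≤
      √3 / 2 * (halfEdge z (j + 1) + halfEdge z (j + 2)) := by
  have h3 := sqrt_three_pos
  have hs := halfEdge_pos hz
  have hper : Function.Periodic (fun m => |wedge (P z m) ((X z).mulVec (root j))|) 3 := by
    intro m
    simp only [P_add_three, wedge_neg_left, abs_neg]
  have hm : |wedge (P z m) ((X z).mulVec (root j))| =
      |wedge (P z (j + (m - j) % 3)) ((X z).mulVec (root j))| := by
    have h := hper.zsmul ((m - j) / 3) (j + (m - j) % 3)
    rw [smul_eq_mul, show j + (m - j) % 3 + (m - j) / 3 * 3 = m by omega] at h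
    exact h
  have h0 : wedge (P z j) ((X z).mulVec (root j)) =
      √3 / 2 * (halfEdge z (j + 1) + halfEdge z (j + 2)) := by
    rw [P_eq_root_add, wedge_add_left, wedge_smul_left, wedge_self, wedge_root_X_self]; ring
  have h1 : wedge (P z (j + 1)) ((X z).mulVec (root j)) =
      √3 / 2 * (halfEdge z (j + 2) - halfEdge z (j + 1)) := by
    rw [P_succ, wedge_add_left, h0, wedge_smul_left, wedge_X_X, wedge_swap, wedge_root_succ]; ring
  have h2 : wedge (P z (j + 2)) ((X z).mulVec (root j)) =
      -(√3 / 2 * (halfEdge z (j + 1) + halfEdge z (j + 2))) := by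
    rw [show j + 2 = j + 1 + 1 by ring, P_succ, wedge_add_left, h1, wedge_smul_left, wedge_X_X,
      show j + 1 + 1 = j + 2 by ring, root_add_two, wedge_sub_left, wedge_self, wedge_swap,
      wedge_root_succ]
    ring
  have hs1 := hs (j + 1)
  have hs2 := hs (j + 2)
  rw [hm]
  have : (m - j) % 3 = 0 ∨ (m - j) % 3 = 1 ∨ (m - j) % 3 = 2 := by omega
  rcases this with h | h | h <;> rw [h]
  · rw [add_zero, h0, abs_of_pos (by positivity)]
  · rw [h1, abs_mul, abs_of_pos (by positivity)]
    gcongr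
    rw [abs_le]
    constructor <;> linarith
  · rw [h2, abs_neg, abs_of_pos (by positivity)]

theorem abs_wedge_le_of_mem_hexagon (hz : z ∈ starDomain) (j : ℤ) {p : Plane}
    (hp : p ∈ hexagon z) :
    |wedge p ((X z).mulVec (root j))| ≤
      √3 / 2 * (halfEdge z (j + 1) + halfEdge z (j + 2)) := by
  have hconv : Convex ℝ {p : Plane | |wedge p ((X z).mulVec (root j))| ≤
      √3 / 2 * (halfEdge z (j + 1) + halfEdge z (j + 2))} := by
    have h : {p : Plane | |wedge p ((X z).mulVec (root j))| ≤
        √3 / 2 * (halfEdge z (j + 1) + halfEdge z (j + 2))} =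
        wedgeLeft ((X z).mulVec (root j)) ⁻¹'
          Set.Icc (-(√3 / 2 * (halfEdge z (j + 1) + halfEdge z (j + 2))))
            (√3 / 2 * (halfEdge z (j + 1) + halfEdge z (j + 2))) := by
      ext p
      simp only [Set.mem_ofPred_eq, Set.mem_preimage, wedgeLeft_apply, Set.mem_Icc, abs_le]
    rw [h]
    exact (convex_Icc _ _).linear_preimage _
  refine convexHull_min ?_ hconv hp
  have h := abs_wedge_P_le hz j
  rintro p (rfl | rfl | rfl | rfl | rfl | rfl) <;>
    simp only [Set.mem_ofPred_eq, wedge_neg_left, abs_neg] <;> apply h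

/-- Cutting off a corner of the hexagon `H(z)` and dropping a side: the cut has to be small. -/
theorem cut_bound (hz : z ∈ starDomain) {K : Set Plane} (hK : ∀ p ∈ K, p ∈ hexagon z)
    (hdet : minDet K = √3 / 2) (j : ℤ) {τ : ℝ} (hτ : 0 ≤ τ) (hτ1 : τ ≤ 1)
    (hcut : ∀ p ∈ K, |wedge p (root (j + 2))| ≤
      √3 / 2 * (1 + (1 - τ) * (halfEdge z j * halfEdge z (j + 1)))) :
    τ ^ 2 * (halfEdge z j * halfEdge z (j + 1)) ≤ 4 * halfEdge z (j + 2) ^ 2 := by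
  rcases hτ.eq_or_lt with rfl | hτ
  · rw [zero_pow two_ne_zero, zero_mul]; positivity
  have h3 := sqrt_three_pos
  have hr := halfEdge_pos hz j
  have hs := halfEdge_pos hz (j + 1)
  have ht := halfEdge_pos hz (j + 2)
  have hrel := halfEdge_relation z j
  have g1 := wedge_root_X_self z j
  have g2 := wedge_root_succ_X_succ z j
  have g3 := wedge_root_X_succ z j
  have g4 := wedge_X_comm z (root (j + 1)) (root j)
  rw [g3] at g4
  have c1 := fun p hp => abs_wedge_le_of_mem_hexagon hz j (hK p hp)
  have c2 := fun p hp => abs_wedge_le_of_mem_hexagon hz (j + 1) (hK p hp)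
  rw [show j + 1 + 2 = j + 3 by ring, show j + 1 + 1 = j + 2 by ring, halfEdge_add_three] at c2
  have hw := wedge_root_succ j
  have hexp := eq_smul_add_smul (by rw [hw]; positivity : wedge (root j) (root (j + 1)) ≠ 0)
  set r := halfEdge z j
  set s := halfEdge z (j + 1)
  set t := halfEdge z (j + 2)
  -- The lines φ = 1 and ψ = 1 carry the sides through e_{j+1} and e_j, and meet at P_j.
  set φ := (√3 / 2 * (r + t))⁻¹ • wedgeLeft ((X z).mulVec (root (j + 1))) with hφ
  set ψ := (√3 / 2 * (s + t))⁻¹ • wedgeLeft ((X z).mulVec (root j)) with hψ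
  -- φ(e_j) = 1 - r/(r+t) and ψ(e_{j+1}) = 1 - s/(s+t), so τ = 1 would cut exactly along the chord.
  set a := τ * (r / (r + t)) with ha
  set b := τ * (s / (s + t)) with hb
  -- The solutions of φ = 1, ψ = -b/2 and of φ = -a/2, ψ = 1 in the basis e_j, e_{j+1}.
  set u := ((r + t) * (-τ * s / 2 - t)) • root j +
    ((s + t) * (r + t) + t * τ * s / 2) • root (j + 1) with hu
  set v := ((s + t) * (r + t) + t * τ * r / 2) • root j +
    ((s + t) * (-τ * r / 2 - t)) • root (j + 1) with hv
  have hφc : ∀ x y : ℝ, φ (x • root j + y • root (j + 1)) = (x * t + y * (r + t)) / (r + t) := by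
    intro x y
    simp only [hφ, LinearMap.smul_apply, wedgeLeft_apply, wedge_add_left, wedge_smul_left, g2, g3,
      smul_eq_mul]
    field_simp
  have hψc : ∀ x y : ℝ, ψ (x • root j + y • root (j + 1)) = (x * (s + t) + y * t) / (s + t) := by
    intro x y
    simp only [hψ, LinearMap.smul_apply, wedgeLeft_apply, wedge_add_left, wedge_smul_left, g1, g4,
      smul_eq_mul]
    field_simp
  have hD : (s + t) * (r + t) = 1 + t ^ 2 := by linear_combination hrel
  have hrs : r * s < 1 := by nlinarith [mul_pos hs ht, mul_pos ht hr]
  have ha1 : a ≤ 1 := by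
    have : r / (r + t) ≤ 1 := by rw [div_le_one (by positivity)]; linarith
    calc a ≤ 1 * 1 := mul_le_mul hτ1 this (by positivity) zero_le_one
      _ = 1 := one_mul 1
  have hb1 : b ≤ 1 := by
    have : s / (s + t) ≤ 1 := by rw [div_le_one (by positivity)]; linarith
    calc b ≤ 1 * 1 := mul_le_mul hτ1 this (by positivity) zero_le_one
      _ = 1 := one_mul 1
  have huv : wedge u v = -(√3 / 2 * (1 + t ^ 2 - τ ^ 2 * (r * s) / 4)) := by
    have e : wedge u v = √3 / 2 * (((r + t) * (-τ * s / 2 - t)) * ((s + t) * (-τ * r / 2 - t)) -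
        ((s + t) * (r + t) + t * τ * s / 2) * ((s + t) * (r + t) + t * τ * r / 2)) := by
      simp only [hu, hv, wedge_add_left, wedge_add_right, wedge_smul_left, wedge_smul_right,
        wedge_self, wedge_swap (root (j + 1)) (root j), hw]
      ring
    rw [e, ← mul_neg]
    congr 1
    have e' : ((r + t) * (-τ * s / 2 - t)) * ((s + t) * (-τ * r / 2 - t)) =
      ((s + t) * (r + t)) * ((-τ * s / 2 - t) * (-τ * r / 2 - t)) := by ring
    rw [e', hD]
    ring
  have hτ2 : τ ^ 2 * (r * s) ≤ 1 := by
    have : τ ^ 2 ≤ 1 := pow_le_one₀ hτ.le hτ1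
    nlinarith [mul_pos hr hs]
  have hpos : 0 < √3 / 2 * (1 + t ^ 2 - τ ^ 2 * (r * s) / 4) := by
    apply mul_pos (by positivity)
    nlinarith [sq_nonneg t]
  have hmin := minDet_le_of_subset_hexagon (K := K) φ ψ (a := a) (b := b) (u := u) (v := v)
    (by positivity) ha1 (by positivity) hb1 (by rw [huv]; exact neg_ne_zero.mpr hpos.ne')
    (by
      rw [hu, hφc, div_eq_one_iff_eq (by positivity)]
      linear_combination (r + t) * hD)
    (by
      rw [hv, hφc, ha]
      field_simp
      linear_combination (-τ * r) * hD)
    (by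
      rw [hu, hψc, hb]
      field_simp
      linear_combination (-τ * s) * hD)
    (by
      rw [hv, hψc, div_eq_one_iff_eq (by positivity)]
      linear_combination (s + t) * hD)
    (by
      intro p hp
      rw [hφ, LinearMap.smul_apply, smul_eq_mul, abs_mul, abs_of_pos (by positivity),
        inv_mul_le_one₀ (by positivity), add_comm r t]
      exact c2 p hp)
    (by
      intro p hp
      rw [hψ, LinearMap.smul_apply, smul_eq_mul, abs_mul, abs_of_pos (by positivity),
        inv_mul_le_one₀ (by positivity)]
      exact c1 p hp)
    (by
      intro p hp
      have hf : b * φ p + a * ψ p =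
          τ / ((s + t) * (r + t)) * (wedge p (root (j + 2)) / (√3 / 2)) := by
        rw [hexp p, hφc, hψc, root_add_two]
        simp only [wedge_add_left, wedge_sub_right, wedge_smul_left, wedge_self,
          wedge_swap (root (j + 1)) (root j), hw]
        rw [ha, hb]
        field_simp
        linear_combination √3 * (wedge p (root (j + 1)) + wedge (root j) p) * hrel
      have hab : a + b - a * b = τ / ((s + t) * (r + t)) * (1 + (1 - τ) * (r * s)) := by
        rw [ha, hb]
        field_simp
        linear_combination hrel
      rw [hf, hab, abs_mul, abs_of_pos (by positivity), abs_div, abs_of_pos (a := √3 / 2)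
        (by positivity)]
      apply mul_le_mul_of_nonneg_left _ (by positivity)
      rw [div_le_iff₀ (by positivity)]
      linarith [hcut p hp])
  rw [hdet, huv, abs_neg, abs_of_pos hpos] at hmin
  have : 1 ≤ 1 + t ^ 2 - τ ^ 2 * (r * s) / 4 :=
    le_of_mul_le_mul_left (by linarith) (by positivity : 0 < √3 / 2)
  linarith

/-- e_{j+2} is parallel to the chord, so maximizing p ∧ e_{j+2} over K maximizes the coordinate sum
α + β, which is 1 on the chord and 1 + rs at P_j. By symmetry the maximum also bounds -p ∧ e_{j+2},
as `cut_bound` requires. -/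
theorem exists_extreme_point (hz : z ∈ starDomain) {K : Set Plane} (hc : IsCompact K)
    (hsymm : ∀ p ∈ K, -p ∈ K) (hK : ∀ p ∈ K, p ∈ hexagon z) (hdet : minDet K = √3 / 2) (j : ℤ)
    (hj : root j ∈ K) :
    ∃ α β τ : ℝ, 0 ≤ α ∧ 0 ≤ β ∧ 0 ≤ τ ∧ τ ≤ 1 ∧ α • root j + β • root (j + 1) ∈ K ∧
      α + β = 1 + (1 - τ) * (halfEdge z j * halfEdge z (j + 1)) ∧
      τ ^ 2 * (halfEdge z j * halfEdge z (j + 1)) ≤ 4 * halfEdge z (j + 2) ^ 2 := by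
  have h3 := sqrt_three_pos
  have hr := halfEdge_pos hz j
  have hs := halfEdge_pos hz (j + 1)
  have ht := halfEdge_pos hz (j + 2)
  have hrel := halfEdge_relation z j
  have hw := wedge_root_succ j
  obtain ⟨σ, hσ, hmax⟩ := hc.exists_isMaxOn ⟨_, hj⟩
    (wedgeLeft (root (j + 2))).continuous_of_finiteDimensional.continuousOn
  have hexp := eq_smul_add_smul (by rw [hw]; positivity : wedge (root j) (root (j + 1)) ≠ 0) σ
  set α := wedge σ (root (j + 1)) / wedge (root j) (root (j + 1))
  set β := wedge (root j) σ / wedge (root j) (root (j + 1))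
  have hwσ : wedge σ (root (j + 2)) = √3 / 2 * (α + β) := by
    rw [hexp, root_add_two]
    simp only [wedge_add_left, wedge_sub_right, wedge_smul_left, wedge_self,
      wedge_swap (root (j + 1)) (root j), hw]
    ring
  have hM : 1 ≤ α + β := by
    have h := hmax hj
    simp only [Set.mem_ofPred_eq, wedgeLeft_apply] at h
    rw [hwσ, root_add_two, wedge_sub_right, wedge_self, hw] at h
    exact le_of_mul_le_mul_left (by linarith) (by positivity : 0 < √3 / 2)
  have c1 := (abs_le.mp (abs_wedge_le_of_mem_hexagon hz j (hK σ hσ))).2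
  have c2 := (abs_le.mp (abs_wedge_le_of_mem_hexagon hz (j + 1) (hK σ hσ))).2
  rw [show j + 1 + 2 = j + 3 by ring, show j + 1 + 1 = j + 2 by ring, halfEdge_add_three] at c2
  rw [hexp, wedge_add_left, wedge_smul_left, wedge_smul_left, wedge_root_X_self,
    wedge_X_comm z (root (j + 1)), wedge_root_X_succ] at c1
  rw [hexp, wedge_add_left, wedge_smul_left, wedge_smul_left, wedge_root_succ_X_succ,
    wedge_root_X_succ] at c2
  rw [hexp] at hσ
  have hpm : ∀ p ∈ K, |wedge p (root (j + 2))| ≤ √3 / 2 * (α + β) := by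
    intro p hp
    have h1 := hmax hp
    have h2 := hmax (hsymm p hp)
    simp only [Set.mem_ofPred_eq, wedgeLeft_apply, wedge_neg_left, hwσ] at h1 h2
    rw [abs_le]
    constructor <;> linarith
  clear_value α β
  clear hexp
  have cut := fun τ h0 h1 => cut_bound hz hK hdet j (τ := τ) h0 h1
  set r := halfEdge z j
  set s := halfEdge z (j + 1)
  set t := halfEdge z (j + 2)
  have c1' : α * (s + t) + β * t ≤ s + t :=
    le_of_mul_le_mul_left (by linarith) (by positivity : 0 < √3 / 2)
  have c2' : α * t + β * (r + t) ≤ r + t :=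
    le_of_mul_le_mul_left (by linarith) (by positivity : 0 < √3 / 2)
  -- With α + β ≥ 1, the side through e_{j+1} gives β ≤ 1; if α were negative, β would exceed 1. The
  -- other coordinate is symmetric.
  have hα : 0 ≤ α := by
    by_contra h
    nlinarith [mul_pos hr (neg_pos.mpr (not_le.mp h))]
  have hβ : 0 ≤ β := by
    by_contra h
    nlinarith [mul_pos hs (neg_pos.mpr (not_le.mp h))]
  have hM1 : α + β ≤ 1 + r * s := by
    have e1 := mul_le_mul_of_nonneg_left c1' hr.le
    have e2 := mul_le_mul_of_nonneg_left c2' hs.le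
    have e3 : α + β = r * (α * (s + t) + β * t) + s * (α * t + β * (r + t)) := by
      linear_combination -(α + β) * hrel
    rw [e3]
    linarith
  have hrs := mul_pos hr hs
  have hτ : α + β = 1 + (1 - (1 + r * s - (α + β)) / (r * s)) * (r * s) := by
    field_simp
    ring
  have h0 : 0 ≤ (1 + r * s - (α + β)) / (r * s) := div_nonneg (by linarith) hrs.le
  have h1 : (1 + r * s - (α + β)) / (r * s) ≤ 1 := by
    rw [div_le_one hrs]; linarith
  exact ⟨α, β, _, hα, hβ, h0, h1, hσ, hτ, cut _ h0 h1 (by rwa [← hτ])⟩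

end

/-! ### Summation over the six sectors -/

/-- The open cone between the consecutive roots of unity `e_j` and `e_{j+1}`. -/
def sector (j : ℤ) : Set Plane :=
  {p | 0 < wedge (root j) p ∧ wedge (root (j + 1)) p < 0}

theorem measurableSet_sector (j : ℤ) : MeasurableSet (sector j) := by
  have h : ∀ u : Plane, Measurable fun p : Plane => wedge u p := fun u => by
    unfold wedge; fun_prop
  exact (measurableSet_lt measurable_const (h _)).inter (measurableSet_lt (h _) measurable_const)

theorem volume_sector_ge {K : Set Plane} (hc : IsCompact K) (hconv : Convex ℝ K) (h0 : 0 ∈ K)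
    (j : ℤ) (hj : root j ∈ K) (hj1 : root (j + 1) ∈ K) {α β : ℝ} (hα : 0 ≤ α) (hβ : 0 ≤ β)
    (hαβ : 0 < α + β) (hσ : α • root j + β • root (j + 1) ∈ K) :
    √3 / 4 * (α + β) ≤ volume.real (K ∩ sector j) := by
  have h3 := sqrt_three_pos
  have hw := wedge_root_succ j
  set e := root j with he
  set e' := root (j + 1) with he'
  have hw' : wedge e' e = -(√3 / 2) := by rw [wedge_swap, hw]
  set σ := α • e + β • e' with hσ'
  have hfin : volume (K ∩ sector j) ≠ ⊤ :=
    (lt_of_le_of_lt (measure_mono Set.inter_subset_left) hc.measure_lt_top).ne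
  have w1 : wedge e σ = √3 / 2 * β := by
    rw [hσ', wedge_add_right, wedge_smul_right, wedge_smul_right, wedge_self, hw]; ring
  have w2 : wedge σ e' = √3 / 2 * α := by
    rw [hσ', wedge_add_left, wedge_smul_left, wedge_smul_left, wedge_self, hw]; ring
  have hsubK : ∀ v ∈ K, ∀ w ∈ K, openTriangle v w ⊆ K := by
    rintro v hv w hw _ ⟨x, y, hx, hy, hxy, rfl⟩
    have := hconv.sum_mem (t := Finset.univ) (w := ![1 - x - y, x, y]) (z := ![0, v, w])
      (by intro i _; fin_cases i <;> simp <;> linarith)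
      (by simp [Fin.sum_univ_three]; ring)
      (by intro i _; fin_cases i <;> simp <;> assumption)
    simpa [Fin.sum_univ_three] using this
  have sub1 : 0 < β → openTriangle e σ ⊆ K ∩ sector j := by
    intro hβ p hp
    refine ⟨hsubK _ hj _ hσ hp, ?_⟩
    obtain ⟨x, y, hx, hy, hxy, rfl⟩ := hp
    simp only [sector, Set.mem_ofPred_eq, ← he, ← he', hσ', wedge_add_right, wedge_smul_right,
      wedge_self, hw, hw']
    constructor
    · have : 0 < y * (β * (√3 / 2)) := by positivity
      linarith
    · have : 0 < x * (√3 / 2) := by positivity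
      have : 0 ≤ y * (α * (√3 / 2)) := by positivity
      linarith
  have sub2 : 0 < α → openTriangle σ e' ⊆ K ∩ sector j := by
    intro hα p hp
    refine ⟨hsubK _ hσ _ hj1 hp, ?_⟩
    obtain ⟨x, y, hx, hy, hxy, rfl⟩ := hp
    simp only [sector, Set.mem_ofPred_eq, ← he, ← he', hσ', wedge_add_right, wedge_smul_right,
      wedge_self, hw, hw']
    constructor
    · have : 0 < y * (√3 / 2) := by positivity
      have : 0 ≤ x * (β * (√3 / 2)) := by positivity
      linarith
    · have : 0 < x * (α * (√3 / 2)) := by positivity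
      linarith
  have v1 : volume.real (openTriangle e σ) = √3 / 4 * β := by
    rw [measureReal_def, volume_openTriangle, w1, ENNReal.toReal_ofReal (by positivity),
      abs_of_nonneg (by positivity)]
    ring
  have v2 : volume.real (openTriangle σ e') = √3 / 4 * α := by
    rw [measureReal_def, volume_openTriangle, w2, ENNReal.toReal_ofReal (by positivity),
      abs_of_nonneg (by positivity)]
    ring
  rcases hβ.eq_or_lt with hβ0 | hβ
  · rw [← hβ0, add_zero, ← v2]
    exact measureReal_mono (sub2 (by linarith)) hfin
  rcases hα.eq_or_lt with hα0 | hα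
  · rw [← hα0, zero_add, ← v1]
    exact measureReal_mono (sub1 hβ) hfin
  -- The line through 0 and σ separates the two triangles.
  have hdisj : Disjoint (openTriangle e σ) (openTriangle σ e') := by
    rw [Set.disjoint_left]
    rintro _ ⟨x, y, hx, hy, hxy, rfl⟩ ⟨x', y', hx', hy', hxy', h⟩
    have h1 : wedge σ (x • e + y • σ) = wedge σ (x' • σ + y' • e') := by rw [h]
    rw [wedge_add_right, wedge_add_right] at h1
    simp only [wedge_smul_right, wedge_self, w2, wedge_swap σ e, w1] at h1
    have : 0 < x * (√3 / 2 * β) := by positivity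
    have : 0 < y' * (√3 / 2 * α) := by positivity
    linarith
  have hm : MeasurableSet (openTriangle σ e') :=
    measurableSet_openTriangle _ _ (by rw [w2]; positivity)
  have hf1 : volume (openTriangle e σ) ≠ ⊤ := by rw [volume_openTriangle]; exact ENNReal.ofReal_ne_top
  have hf2 : volume (openTriangle σ e') ≠ ⊤ := by rw [volume_openTriangle]; exact ENNReal.ofReal_ne_top
  calc √3 / 4 * (α + β) = volume.real (openTriangle e σ ∪ openTriangle σ e') := by
        rw [measureReal_union hdisj hm hf1 hf2, v1, v2]; ring
    _ ≤ _ := measureReal_mono (Set.union_subset (sub1 hβ) (sub2 hα)) hfin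

theorem sum_volume_sector_le {K : Set Plane} (hc : IsCompact K) :
    ∑ i : Fin 6, volume.real (K ∩ sector (i : ℕ)) ≤ volume.real K := by
  have hfin : volume K ≠ ⊤ := hc.measure_lt_top.ne
  have hdisj : Pairwise (Function.onFun Disjoint fun i : Fin 6 => K ∩ sector (i : ℕ)) := by
    intro i k hik
    simp only [Function.onFun]
    rw [Set.disjoint_left]
    rintro p ⟨_, hi, hi'⟩ ⟨_, hk, hk'⟩
    -- The values e_k ∧ p obey a linear recursion, so they cannot pass from positive to negative at
    -- two different places in one turn.
    have w : ∀ j : ℤ, wedge (root (j + 2)) p = wedge (root (j + 1)) p - wedge (root j) p :=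
      fun j => by rw [root_add_two, wedge_sub_left]
    have w0 := w 0
    have w1 := w 1
    have w2 := w 2
    have w3 := w 3
    have w4 := w 4
    norm_num at w0 w1 w2 w3 w4
    fin_cases i <;> fin_cases k <;> first | exact hik rfl | (norm_num at hi hi' hk hk'; linarith)
  rw [← measureReal_iUnion_fintype hdisj
    (fun i => hc.measurableSet.inter (measurableSet_sector _))
    (fun i => (lt_of_le_of_lt (measure_mono Set.inter_subset_left) hc.measure_lt_top).ne)]
  exact measureReal_mono (Set.iUnion_subset fun i => Set.inter_subset_left) hfin

/-- On the region, τ² T ≤ A gives τT ≤ √(AT); off it, `area` is 0 and τ ≤ 1 suffices. -/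
theorem area_le {z : UpperHalfPlane} (hz : z ∈ starDomain) (i : Fin 3) {τ : ℝ} (hτ1 : τ ≤ 1)
    (h : τ ^ 2 * (halfEdge z (i : ℕ) * halfEdge z ((i : ℕ) + 1)) ≤
      4 * halfEdge z ((i : ℕ) + 2) ^ 2) :
    area i z ≤ √3 / 4 * ((1 - τ) * (halfEdge z (i : ℕ) * halfEdge z ((i : ℕ) + 1))) := by
  have h3 := sqrt_three_pos
  have hr := halfEdge_pos hz (i : ℕ)
  have hs := halfEdge_pos hz ((i : ℕ) + 1)
  have hA := A_succ_eq hz i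
  have hT := T_eq hz i
  unfold area Set.indicator
  split_ifs
  · have hTpos : 0 < T i z := by rw [hT]; positivity
    have h1 : τ * T i z ≤ √(A (i + 1) z * T i z) := by
      apply Real.le_sqrt_of_sq_le
      have : τ ^ 2 * T i z ≤ A (i + 1) z := by
        rw [hT, hA]
        have := mul_le_mul_of_nonneg_left h h3.le
        linarith
      nlinarith
    have h2 : √3 / 4 * ((1 - τ) * (halfEdge z (i : ℕ) * halfEdge z ((i : ℕ) + 1))) =
        T i z - τ * T i z := by rw [hT]; ring
    linarith
  · have : 0 ≤ 1 - τ := by linarith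
    positivity

theorem volume_sector_ge_area {z : UpperHalfPlane} (hz : z ∈ starDomain) {K : Set Plane}
    (hc : IsCompact K) (hconv : Convex ℝ K) (hsymm : ∀ p ∈ K, -p ∈ K)
    (hK : ∀ p ∈ K, p ∈ hexagon z) (hdet : minDet K = √3 / 2) (hroot : ∀ j, root j ∈ K)
    (h0 : 0 ∈ K) (i : Fin 3) :
    √3 / 4 + area i z ≤ volume.real (K ∩ sector (i : ℕ)) ∧
      √3 / 4 + area i z ≤ volume.real (K ∩ sector ((i : ℕ) + 3)) := by
  have key : ∀ j : ℤ, ∃ τ : ℝ, 0 ≤ τ ∧ τ ≤ 1 ∧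
      τ ^ 2 * (halfEdge z j * halfEdge z (j + 1)) ≤ 4 * halfEdge z (j + 2) ^ 2 ∧
      √3 / 4 * (1 + (1 - τ) * (halfEdge z j * halfEdge z (j + 1))) ≤
        volume.real (K ∩ sector j) := by
    intro j
    obtain ⟨α, β, τ, hα, hβ, hτ, hτ1, hσ, hsum, hcut⟩ :=
      exists_extreme_point hz hc hsymm hK hdet j (hroot j)
    have hpos : 0 < α + β := by
      rw [hsum]
      have := halfEdge_pos hz j
      have := halfEdge_pos hz (j + 1)
      have : 0 ≤ 1 - τ := by linarith
      positivity
    refine ⟨τ, hτ, hτ1, hcut, ?_⟩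
    rw [← hsum]
    exact volume_sector_ge hc hconv h0 j (hroot _) (hroot _) hα hβ hpos hσ
  constructor
  · obtain ⟨τ, hτ, hτ1, hcut, hvol⟩ := key (i : ℕ)
    have := area_le hz i hτ1 hcut
    linarith
  · obtain ⟨τ, hτ, hτ1, hcut, hvol⟩ := key ((i : ℕ) + 3)
    rw [show ((i : ℕ) : ℤ) + 3 + 1 = (i : ℕ) + 1 + 3 by ring,
      show ((i : ℕ) : ℤ) + 3 + 2 = (i : ℕ) + 2 + 3 by ring] at hcut
    rw [show ((i : ℕ) : ℤ) + 3 + 1 = (i : ℕ) + 1 + 3 by ring] at hvol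
    simp only [halfEdge_add_three] at hcut hvol
    have := area_le hz i hτ1 hcut
    linarith

theorem volume_ge_of_isCriticalHexagon {K : Set Plane} (hK : K ∈ Kccs) (hcirc : InCircleRep K)
    {z : UpperHalfPlane} (hz : z ∈ starDomain) (hH : IsCriticalHexagon K (hexagon z)) :
    volume.real K ≥ 3 * √3 / 2 + 2 * ∑ i : Fin 3, area i z := by
  obtain ⟨hc, hconv, hsymm⟩ := hK
  obtain ⟨hfr, hdet⟩ := hcirc
  have hroot : ∀ j, root j ∈ K := fun j => hc.isClosed.frontier_subset (hfr j)
  have h0 : (0 : Plane) ∈ K := by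
    have := hconv (hroot 0) (hsymm _ (hroot 0)) (a := 1 / 2) (b := 1 / 2) (by norm_num)
      (by norm_num) (by norm_num)
    simpa using this
  have hsub : ∀ p ∈ K, p ∈ hexagon z := by
    obtain ⟨L, E, l, _, _, _, hl, hE⟩ := hH
    intro p hp
    rw [hE]
    -- 0 lies in K, so no support line separates it from p or from -p; hence K lies in H(z).
    exact fun i => ⟨(hl i).1.2.2 0 h0 p hp, (hl i).1.2.2 0 h0 (-p) (hsymm p hp)⟩
  have hsec := volume_sector_ge_area hz hc hconv hsymm hsub hdet hroot h0
  have hsum := sum_volume_sector_le hc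
  have a0 := hsec 0
  have a1 := hsec 1
  have a2 := hsec 2
  norm_num [Fin.sum_univ_succ] at a0 a1 a2 hsum ⊢
  linarith

end Reinhardt

theorem mainTheorem7 :
    (∀ K ∈ Reinhardt.Kbal, Reinhardt.InCircleRep K →
      ∀ z ∈ Reinhardt.region 0 ∪ Reinhardt.region 1 ∪ Reinhardt.region 2,
        Reinhardt.IsCriticalHexagon K (Reinhardt.hexagon z) →
          MeasureTheory.volume.real K ≥
            3 * Real.sqrt 3 / 2 + 2 * ∑ i : Fin 3, Reinhardt.area i z) ∧
    Reinhardt.region 0 ∩ Reinhardt.region 1 ∩ Reinhardt.region 2 = ∅ := by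
  refine ⟨?_, Reinhardt.region_inter_eq_empty⟩
  intro K hK hcirc z hz hH
  have hz' : z ∈ Reinhardt.starDomain := by
    rcases hz with (h | h) | h <;> exact h.1
  exact Reinhardt.volume_ge_of_isCriticalHexagon hK.1 hcirc hz' hH
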